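/- Conventions. For $m\in\mathbb{Z}$ let $J_m$ be the Bessel function of the first kind of order $m$ (so $J_{-m}=(-1)^mJ_m$), and for $n\in\mathbb{N}=\{1,2,\dots\}$ let $z_{mn}$ be the $n$-th positive zero of $J_m$ in increasing order. For $a>0$ put $\rho_{nm}:=a^{-1}z_{mn}$, $N_n^{(m)}(a):=\frac{a^2}{2}J_m'(z_{mn})^2$ and $$\Psi^a_{nm}(r,\theta):=\frac{1}{\sqrt{N_n^{(m)}(a)}}\,J_m(\rho_{nm}r)\,\frac{1}{\sqrt{2\pi}}\,e^{\mathrm{i}m\theta}.$$ For a function $f$ on $\mathbb{R}^2$ write $f(r,\theta):=f(r\cos\theta,r\sin\theta)$. Its Fourier–Bessel coefficients on the disk of radius $a$ are $$C^a_{n,m}[f]:=\int_0^a\int_0^{2\pi}f(r,\theta)\,\overline{\Psi^a_{nm}(r,\theta)}\,r\,dr\,d\theta ,$$ and its Fourier transform restricted to the disk of radius $b$ is $$\widehat f[\boldsymbol\omega;b]:=\int_0^b\int_0^{2\pi}f(r,\theta)\,e^{-\pi\mathrm{i}r(\omega_1\cos\theta+\omega_2\sin\theta)}\,r\,dr\,d\theta\qquad(\boldsymbol\omega\in\mathbb{R}^2).$$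 Let $\mathbb{B}_b^2$ be the closed disk of radius $b$ centred at $0$ in $\mathbb{R}^2$. The zero-padded convolution is $f_1\circledast f_2:=(f_1\mathbf 1_{\mathbb{B}_b^2})*(f_2\mathbf 1_{\mathbb{B}_b^2})$, with $(g*h)(\mathbf x)=\int_{\mathbb{R}^2}g(\mathbf y)h(\mathbf x-\mathbf y)\,d\mathbf y$. For $\mathbf k\in\mathbb{Z}^2$ let $|\mathbf k|$ be its Euclidean norm and $\Phi(\mathbf k)\in[0,2\pi)$ its polar angle (with $\Phi(\mathbf 0)=0$), and put $$c_a(\mathbf k;n,m):=\sqrt{\pi}\,(-1)^n\,\mathrm{i}^{|m|}\,\rho_{nm}\,\frac{J_m(\pi|\mathbf k|)\,e^{-\mathrm{i}m\Phi(\mathbf k)}}{2\,(\pi^2|\mathbf k|^2-z_{mn}^2)},$$ where, if $\pi|\mathbf k|=z_{mn}$, the quotient $J_m(x)/(x^2-z_{mn}^2)$ at $x=\pi|\mathbf k|$ is understood as its limit $J_m'(z_{mn})/(2z_{mn})$. Theorem. Let $a>0$ and $b:=a/2$, and let $f_1,f_2:\mathbb{R}^2\to\mathbb{C}$ be square-integrable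 on $\mathbb{B}_b^2$. Then for all $m\in\mathbb{Z}$ and $n\in\mathbb{N}$ $$C^a_{n,m}[f_1\circledast f_2]=\sum_{\mathbf k\in\mathbb{Z}^2}c_a(\mathbf k;n,m)\,\widehat{f_1}[a^{-1}\mathbf k;b]\,\widehat{f_2}[a^{-1}\mathbf k;b],$$ the series over $\mathbb{Z}^2$ converging unconditionally. -/

import Mathlib

open MeasureTheory

noncomputable section

/-- The Euclidean plane `ℝ²`. -/
abbrev Plane : Type := EuclideanSpace ℝ (Fin 2)

/-- The Bessel function of the first kind `J_m` of integer order `m`, given by Bessel's integral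
`J_m(x) = (1/π) ∫_0^π cos(m t - x sin t) dt` (valid for all integers `m`;
in particular `J_{-m} = (-1)^m J_m`). -/
def besselJ (m : ℤ) (x : ℝ) : ℝ :=
  (1 / Real.pi) * ∫ t in (0 : ℝ)..Real.pi, Real.cos ((m : ℝ) * t - x * Real.sin t)

/-- For `n ≥ 1`, `besselZero m n` is `z_{mn}`, the `n`-th positive zero of `J_m` in increasing
order: each one is the least zero beyond the previous one. The value `0` at `n = 0` is only the
starting point of the recursion. -/
def besselZero (m : ℤ) : ℕ → ℝ
  | 0 => 0
  | n + 1 => sInf {x : ℝ | besselZero m n < x ∧ besselJ m x = 0}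

/-- `ρ_{nm} = a⁻¹ z_{mn}`. -/
def besselRho (a : ℝ) (n : ℕ) (m : ℤ) : ℝ := a⁻¹ * besselZero m n

/-- The normalization constant `N_n^{(m)}(a) = (a² / 2) J_m'(z_{mn})²`. -/
def besselNorm (a : ℝ) (n : ℕ) (m : ℤ) : ℝ :=
  a ^ 2 / 2 * deriv (besselJ m) (besselZero m n) ^ 2

/-- The normalized radial function `𝒥_{nm}^a(r) = N_n^{(m)}(a)^{-1/2} J_m(ρ_{nm} r)`. -/
def radialBessel (a : ℝ) (n : ℕ) (m : ℤ) (r : ℝ) : ℝ :=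
  1 / Real.sqrt (besselNorm a n m) * besselJ m (besselRho a n m * r)

/-- The angular function `𝒴_m(θ) = (2π)^{-1/2} exp(i m θ)`. -/
def angularHarmonic (m : ℤ) (θ : ℝ) : ℂ :=
  ((1 / Real.sqrt (2 * Real.pi) : ℝ) : ℂ) * Complex.exp (Complex.I * m * θ)

/-- The Fourier-Bessel basis function `Ψ_{nm}^a(r, θ) = 𝒥_{nm}^a(r) 𝒴_m(θ)`, in polar
coordinates. -/
def fourierBesselBasis (a : ℝ) (n : ℕ) (m : ℤ) (r θ : ℝ) : ℂ :=
  (radialBessel a n m r : ℂ) * angularHarmonic m θ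

/-- The point `r u_θ = (r cos θ, r sin θ)` of the plane. -/
def polarPoint (r θ : ℝ) : Plane := !₂[r * Real.cos θ, r * Real.sin θ]

/-- The Fourier-Bessel coefficient
`C_{n,m}^a[f] = ∫_0^a ∫_0^{2π} f(r, θ) conj(Ψ_{nm}^a(r, θ)) r dr dθ`,
of (the restriction to the disk of radius `a` of) a function `f` on the plane. -/
def fourierBesselCoeff (a : ℝ) (n : ℕ) (m : ℤ) (f : Plane → ℂ) : ℂ :=
  ∫ r in (0 : ℝ)..a, ∫ θ in (0 : ℝ)..(2 * Real.pi),
    f (polarPoint r θ) * (starRingEnd ℂ) (fourierBesselBasis a n m r θ) * (r : ℂ)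

/-- The extension by zero of the restriction of `f` to the closed disk of radius `b`. -/
def zeroPad (b : ℝ) (f : Plane → ℂ) : Plane → ℂ :=
  (Metric.closedBall (0 : Plane) b).indicator f

/-- The zero-padded convolution `f₁ ⊛ f₂` with respect to the disk of radius `b`: the convolution
`x ↦ ∫ f₁(y) f₂(x - y) dy` of the two functions restricted to the disk and extended by zero. -/
def zeroPaddedConv (b : ℝ) (f₁ f₂ : Plane → ℂ) : Plane → ℂ :=
  convolution (zeroPad b f₁) (zeroPad b f₂) (ContinuousLinearMap.mul ℝ ℂ) volume

/-- The disk-restricted Fourier transform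
`f̂[ω; b] = ∫_0^b ∫_0^{2π} f(r, θ) exp(-π i r (ω₁ cos θ + ω₂ sin θ)) r dr dθ`. -/
def diskFourier (b : ℝ) (f : Plane → ℂ) (ω : Plane) : ℂ :=
  ∫ r in (0 : ℝ)..b, ∫ θ in (0 : ℝ)..(2 * Real.pi),
    f (polarPoint r θ) *
      Complex.exp (-(Real.pi * Complex.I * r *
        ((ω 0 * Real.cos θ + ω 1 * Real.sin θ : ℝ) : ℂ))) * (r : ℂ)

/-- The lattice vector `k = (k₁, k₂)` as a point of the plane. -/
def latticePoint (k : ℤ × ℤ) : Plane := !₂[(k.1 : ℝ), (k.2 : ℝ)]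

/-- The polar angle `Φ(x) ∈ [0, 2π)` of a point of the plane, with `Φ(0) = 0`. -/
def polarAngle (x : Plane) : ℝ :=
  toIcoMod Real.two_pi_pos 0 (Complex.arg (Complex.mk (x 0) (x 1)))

/-- The function `x ↦ J_m(x) / (x² - z²)` on `[0, ∞)`, for a positive zero `z` of `J_m`, with the
removable singularity at `x = z` filled in by its limit `J_m'(z) / (2 z)`. -/
def besselQuotient (m : ℤ) (z x : ℝ) : ℝ :=
  if x = z then deriv (besselJ m) z / (2 * z) else besselJ m x / (x ^ 2 - z ^ 2)

/-- The coefficient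
`c_a(k; n, m) = √π (-1)^n i^{|m|} ρ_{nm} J_m(π|k|) e^{-i m Φ(k)} / (2 (π²|k|² - z_{mn}²))`. -/
def latticeCoeff (a : ℝ) (k : ℤ × ℤ) (n : ℕ) (m : ℤ) : ℂ :=
  (Real.sqrt Real.pi : ℂ) * (-1) ^ n * Complex.I ^ m.natAbs * (besselRho a n m : ℂ) *
    (besselQuotient m (besselZero m n) (Real.pi * ‖latticePoint k‖) : ℂ) *
    Complex.exp (-(Complex.I * m * polarAngle (latticePoint k))) / 2

end

/-!
The functions `Ψ_{nm}^a`, extended by zero, and `f₁ ⊛ f₂` are both square-integrable and supported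
in the disk of radius `a = 2 b`, hence in the square `[-a, a]²`. The exponentials
`exp(π i k·x / a)`, `k ∈ ℤ²`, are an orthogonal basis of `L²` of that square, so Parseval's identity
(`hasSum_planeFourier`, transported from the torus) writes the Fourier–Bessel coefficient
`∫ (f₁ ⊛ f₂) conj Ψ` as an unconditionally convergent sum of products of Fourier coefficients. Those
of `f₁ ⊛ f₂` are the products `f̂₁[k / a; b] f̂₂[k / a; b]` (`planeFourier_convolution`,
`diskFourier_eq_planeFourier`), and those of `Ψ_{nm}^a` are computed in closed form
(`planeFourier_planeFourierBessel`, `latticeCoeff_eq`): the angular integral of a plane wave against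
`exp(i m θ)` is a Bessel function (`integral_exp_mul_planeWave`), and the radial integral is a Lommel
integral (`integral_besselJ_mul_besselJ_of_zero`).

The closed form contains `J_m'(z_{mn}) / |J_m'(z_{mn})|`, and the factor `(-1) ^ n` of the theorem is
the statement that this sign alternates with `n`. This requires the qualitative theory of the zeros
(`besselZero_spec`): `J_m` has infinitely many positive zeros, by Sturm comparison
(`not_forall_besselJ_pos`); they are simple, because a double zero would make the normalization
integral vanish (`deriv_besselJ_ne_zero`); and `J_m > 0` to the right of `0` for `m ≥ 0`. All facts
about `J_m` are derived from Bessel's integral through the two recurrences `hasDerivAt_besselJ` and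
`besselJ_recurrence`.
-/

/-! ### The Bessel equation and the recurrences -/

lemma continuous_besselJ_integrand (m : ℤ) (x : ℝ) :
    Continuous fun t : ℝ => Real.cos ((m : ℝ) * t - x * Real.sin t) := by
  fun_prop

/-- The recurrence `2 J_m' = J_{m-1} - J_{m+1}`. -/
lemma hasDerivAt_besselJ (m : ℤ) (x : ℝ) :
    HasDerivAt (besselJ m) ((besselJ (m - 1) x - besselJ (m + 1) x) / 2) x := by
  have key := (intervalIntegral.hasDerivAt_integral_of_dominated_loc_of_deriv_le
    (μ := volume) (a := 0) (b := Real.pi) (x₀ := x) (s := Set.univ) (bound := fun _ => 1)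
    (F := fun x t => Real.cos ((m : ℝ) * t - x * Real.sin t))
    (F' := fun x t => Real.sin t * Real.sin ((m : ℝ) * t - x * Real.sin t))
    Filter.univ_mem
    (Filter.Eventually.of_forall fun y => (by fun_prop : Continuous _).aestronglyMeasurable)
    ((continuous_besselJ_integrand m x).intervalIntegrable _ _)
    ((by fun_prop : Continuous _).aestronglyMeasurable)
    (Filter.Eventually.of_forall fun t _ y _ => by
      rw [Real.norm_eq_abs, abs_mul]
      exact mul_le_one₀ (Real.abs_sin_le_one _) (abs_nonneg _) (Real.abs_sin_le_one _))
    intervalIntegrable_const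
    (Filter.Eventually.of_forall fun t _ y _ => by
      have h := (((hasDerivAt_id y).mul_const (Real.sin t)).const_sub ((m : ℝ) * t)).cos
      refine h.congr_deriv ?_
      simp only [id]
      ring)).2
  refine (key.const_mul (1 / Real.pi)).congr_deriv ?_
  have h : (fun t => Real.sin t * Real.sin ((m : ℝ) * t - x * Real.sin t)) = fun t =>
      (1 / 2) * (Real.cos (((m - 1 : ℤ) : ℝ) * t - x * Real.sin t) -
        Real.cos (((m + 1 : ℤ) : ℝ) * t - x * Real.sin t)) := by
    funext t
    rw [show ((m - 1 : ℤ) : ℝ) * t - x * Real.sin t = ((m : ℝ) * t - x * Real.sin t) - t by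
        push_cast; ring,
      show ((m + 1 : ℤ) : ℝ) * t - x * Real.sin t = ((m : ℝ) * t - x * Real.sin t) + t by
        push_cast; ring, Real.cos_sub _ t, Real.cos_add _ t]
    ring
  rw [h, intervalIntegral.integral_const_mul, intervalIntegral.integral_sub
    ((continuous_besselJ_integrand _ x).intervalIntegrable _ _)
    ((continuous_besselJ_integrand _ x).intervalIntegrable _ _)]
  unfold besselJ
  ring

/-- The recurrence `x (J_{m-1} + J_{m+1}) = 2 m J_m`. -/
lemma besselJ_recurrence (m : ℤ) (x : ℝ) :
    x * (besselJ (m - 1) x + besselJ (m + 1) x) = 2 * m * besselJ m x := by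
  -- Up to a constant factor, the difference of the two sides is the integral over `[0, π]` of the
  -- derivative of `sin (m t - x sin t)`, which vanishes at both ends.
  have key : ∫ t in (0 : ℝ)..Real.pi, Real.cos ((m : ℝ) * t - x * Real.sin t) *
      (m - x * Real.cos t) = 0 := by
    rw [intervalIntegral.integral_eq_sub_of_hasDerivAt
      (f := fun t => Real.sin ((m : ℝ) * t - x * Real.sin t))]
    · simp [Real.sin_int_mul_pi]
    · intro t _
      have h := (((hasDerivAt_id t).const_mul (m : ℝ)).sub
        ((Real.hasDerivAt_sin t).const_mul x)).sin
      simpa using h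
    · exact (by fun_prop : Continuous _).intervalIntegrable _ _
  have h : (fun t => Real.cos ((m : ℝ) * t - x * Real.sin t) * (m - x * Real.cos t)) = fun t =>
      m * Real.cos ((m : ℝ) * t - x * Real.sin t) -
      (x / 2) * (Real.cos (((m - 1 : ℤ) : ℝ) * t - x * Real.sin t) +
        Real.cos (((m + 1 : ℤ) : ℝ) * t - x * Real.sin t)) := by
    funext t
    rw [show ((m - 1 : ℤ) : ℝ) * t - x * Real.sin t = ((m : ℝ) * t - x * Real.sin t) - t by
        push_cast; ring,
      show ((m + 1 : ℤ) : ℝ) * t - x * Real.sin t = ((m : ℝ) * t - x * Real.sin t) + t by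
        push_cast; ring, Real.cos_sub _ t, Real.cos_add _ t]
    ring
  have hi := fun n : ℤ => (continuous_besselJ_integrand n x).intervalIntegrable
    (μ := volume) 0 Real.pi
  rw [h, intervalIntegral.integral_sub ((hi _).const_mul _)
      (((hi _).add (hi _)).const_mul _), intervalIntegral.integral_const_mul,
    intervalIntegral.integral_const_mul, intervalIntegral.integral_add (hi _) (hi _)] at key
  unfold besselJ
  linear_combination (-2 / Real.pi) * key

lemma deriv_besselJ (m : ℤ) :
    deriv (besselJ m) = fun x => (besselJ (m - 1) x - besselJ (m + 1) x) / 2 :=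
  funext fun x => (hasDerivAt_besselJ m x).deriv

lemma differentiable_besselJ (m : ℤ) : Differentiable ℝ (besselJ m) :=
  fun x => (hasDerivAt_besselJ m x).differentiableAt

@[fun_prop]
lemma continuous_besselJ (m : ℤ) : Continuous (besselJ m) :=
  (differentiable_besselJ m).continuous

@[fun_prop]
lemma continuous_deriv_besselJ (m : ℤ) : Continuous (deriv (besselJ m)) := by
  rw [deriv_besselJ]
  fun_prop

lemma hasDerivAt_besselJ_deriv (m : ℤ) (x : ℝ) :
    HasDerivAt (besselJ m) (deriv (besselJ m) x) x :=
  (differentiable_besselJ m x).hasDerivAt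

lemma differentiable_deriv_besselJ (m : ℤ) : Differentiable ℝ (deriv (besselJ m)) := by
  rw [deriv_besselJ]
  exact ((differentiable_besselJ _).sub (differentiable_besselJ _)).div_const 2

/-- Bessel's differential equation. -/
lemma besselJ_ode (m : ℤ) (x : ℝ) :
    x ^ 2 * deriv (deriv (besselJ m)) x + x * deriv (besselJ m) x +
      (x ^ 2 - m ^ 2) * besselJ m x = 0 := by
  have h2 : deriv (deriv (besselJ m)) x =
      (deriv (besselJ (m - 1)) x - deriv (besselJ (m + 1)) x) / 2 := by
    conv_lhs => rw [deriv_besselJ m]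
    exact (((hasDerivAt_besselJ_deriv _ x).sub (hasDerivAt_besselJ_deriv _ x)).div_const 2).deriv
  have r0 := besselJ_recurrence m x
  have r1 := besselJ_recurrence (m - 1) x
  have r2 := besselJ_recurrence (m + 1) x
  rw [h2]
  simp only [deriv_besselJ]
  simp only [sub_add_cancel, add_sub_cancel_right] at r1 r2 ⊢
  push_cast at r1 r2
  linear_combination (x / 4) * r1 + (x / 4) * r2 + (m / 2 : ℝ) * r0

lemma besselJ_neg (m : ℤ) (x : ℝ) : besselJ (-m) x = (-1) ^ m.natAbs * besselJ m x := by
  unfold besselJ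
  have h := intervalIntegral.integral_comp_sub_left
    (fun t => Real.cos (((-m : ℤ) : ℝ) * t - x * Real.sin t)) Real.pi (a := 0) (b := Real.pi)
  rw [sub_self, sub_zero] at h
  rw [← h, mul_left_comm,
    ← intervalIntegral.integral_const_mul ((-1 : ℝ) ^ m.natAbs)]
  congr 1
  refine intervalIntegral.integral_congr (μ := volume) fun t _ => ?_
  simp only [Real.sin_pi_sub]
  rw [show ((-m : ℤ) : ℝ) * (Real.pi - t) - x * Real.sin t =
    ((m : ℝ) * t - x * Real.sin t) - m * Real.pi by push_cast; ring, Real.cos_sub_int_mul_pi]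
  congr 1
  rcases Int.even_or_odd m with hm | hm
  · rw [hm.neg_one_zpow, (Int.natAbs_even.2 hm).neg_one_pow]
  · rw [hm.neg_one_zpow, (Int.natAbs_odd.2 hm).neg_one_pow]

lemma besselJ_zero_arg {m : ℤ} (hm : m ≠ 0) : besselJ m 0 = 0 := by
  have h := besselJ_recurrence m 0
  have : (m : ℝ) ≠ 0 := by exact_mod_cast hm
  simpa [this] using h

lemma besselJ_zero_zero : besselJ 0 0 = 1 := by
  simp [besselJ, Real.pi_ne_zero]

/-- `x ^ m * J_m` is a primitive of `x ^ m * J_{m - 1}`. -/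
lemma hasDerivAt_pow_mul_besselJ (m : ℕ) (x : ℝ) :
    HasDerivAt (fun x => x ^ (m + 1) * besselJ (m + 1 : ℕ) x) (x ^ (m + 1) * besselJ m x) x := by
  refine ((hasDerivAt_pow (m + 1) x).mul (hasDerivAt_besselJ _ x)).congr_deriv ?_
  have r := besselJ_recurrence ((m + 1 : ℕ) : ℤ) x
  have e : ((m + 1 : ℕ) : ℤ) - 1 = m := by push_cast; ring
  rw [e] at r ⊢
  push_cast at r ⊢
  rw [pow_succ]
  linear_combination (-(x ^ m / 2)) * r

/-- For `m ≥ 0`, `J_m` is positive to the right of `0`: by induction on `m`, the function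
`x ^ m * J_m` vanishes at `0` and has positive derivative. -/
lemma besselJ_pos_near_zero (m : ℕ) : ∃ δ > 0, ∀ x, 0 < x → x < δ → 0 < besselJ m x := by
  induction m with
  | zero =>
    have h : ∀ᶠ x in nhds (0 : ℝ), 0 < besselJ 0 x :=
      (continuous_besselJ 0).continuousAt.eventually (lt_mem_nhds (by
        rw [besselJ_zero_zero]; exact one_pos))
    obtain ⟨δ, hδ, h⟩ := Metric.eventually_nhds_iff.1 h
    exact ⟨δ, hδ, fun x h0 h1 => h (by rwa [Real.dist_eq, sub_zero, abs_of_pos h0])⟩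
  | succ m ih =>
    obtain ⟨δ, hδ, h⟩ := ih
    refine ⟨δ, hδ, fun x h0 h1 => ?_⟩
    have hmono : StrictMonoOn (fun x => x ^ (m + 1) * besselJ (m + 1 : ℕ) x) (Set.Ico 0 δ) := by
      refine strictMonoOn_of_deriv_pos (convex_Ico 0 δ) (by fun_prop) fun y hy => ?_
      rw [interior_Ico] at hy
      rw [(hasDerivAt_pow_mul_besselJ m y).deriv]
      exact mul_pos (pow_pos hy.1 _) (h y hy.1 hy.2)
    have := hmono ⟨le_rfl, hδ⟩ ⟨h0.le, h1⟩ h0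
    simp only [ne_eq, Nat.succ_ne_zero, not_false_eq_true, zero_pow, zero_mul] at this
    exact pos_of_mul_pos_right this (pow_pos h0 _).le

/-! ### Lommel integrals -/

lemma hasDerivAt_comp_mul_of_differentiable {f : ℝ → ℝ} (hf : Differentiable ℝ f) (c s : ℝ) :
    HasDerivAt (fun s => f (c * s)) (c * deriv f (c * s)) s := by
  have h := (hf (c * s)).hasDerivAt.comp s ((hasDerivAt_id s).const_mul c)
  refine h.congr_deriv ?_
  ring

/-- The Wronskian of `J_m(z s)` and `J_m(κ s)`, multiplied by `s`, is a primitive of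
`(z² - κ²) s J_m(z s) J_m(κ s)`. -/
lemma integral_besselJ_mul_besselJ (m : ℤ) (z κ : ℝ) :
    (z ^ 2 - κ ^ 2) * ∫ s in (0 : ℝ)..1, s * (besselJ m (z * s) * besselJ m (κ * s)) =
      κ * besselJ m z * deriv (besselJ m) κ - z * deriv (besselJ m) z * besselJ m κ := by
  have h := intervalIntegral.integral_eq_sub_of_hasDerivAt_of_le (zero_le_one' ℝ)
    (f := fun s => s * (κ * (besselJ m (z * s) * deriv (besselJ m) (κ * s)) -
      z * (deriv (besselJ m) (z * s) * besselJ m (κ * s))))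
    (f' := fun s => (z ^ 2 - κ ^ 2) * (s * (besselJ m (z * s) * besselJ m (κ * s))))
    (by fun_prop) ?_ ((by fun_prop : Continuous _).intervalIntegrable _ _)
  · rw [intervalIntegral.integral_const_mul] at h
    simp only [mul_one, one_mul, zero_mul, sub_zero] at h
    rw [h]
    ring
  · intro s hs
    have hu := hasDerivAt_comp_mul_of_differentiable (differentiable_besselJ m) z s
    have hv := hasDerivAt_comp_mul_of_differentiable (differentiable_besselJ m) κ s
    have hu' := hasDerivAt_comp_mul_of_differentiable (differentiable_deriv_besselJ m) z s
    have hv' := hasDerivAt_comp_mul_of_differentiable (differentiable_deriv_besselJ m) κ s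
    have h := (hasDerivAt_id s).mul (((hu.mul hv').const_mul κ).sub ((hu'.mul hv).const_mul z))
    refine h.congr_deriv ?_
    have o1 := besselJ_ode m (z * s)
    have o2 := besselJ_ode m (κ * s)
    apply mul_left_cancel₀ hs.1.ne'
    simp only [id, Pi.mul_apply, Pi.sub_apply]
    linear_combination besselJ m (z * s) * o2 - besselJ m (κ * s) * o1

/-- The normalization integral, from the primitive
`((z s J_m'(z s))² + ((z s)² - m²) J_m(z s)²) / 2` of `z² s J_m(z s)²`. -/
lemma integral_besselJ_sq (m : ℤ) {z : ℝ} (hz : besselJ m z = 0) :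
    z ^ 2 * ∫ s in (0 : ℝ)..1, s * (besselJ m (z * s) * besselJ m (z * s)) =
      z ^ 2 * deriv (besselJ m) z ^ 2 / 2 := by
  have h := intervalIntegral.integral_eq_sub_of_hasDerivAt_of_le (zero_le_one' ℝ)
    (f := fun s => ((z * s * deriv (besselJ m) (z * s)) ^ 2 +
      ((z * s) ^ 2 - m ^ 2) * besselJ m (z * s) ^ 2) / 2)
    (f' := fun s => z ^ 2 * (s * (besselJ m (z * s) * besselJ m (z * s))))
    (by fun_prop) ?_ ((by fun_prop : Continuous _).intervalIntegrable _ _)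
  · rw [intervalIntegral.integral_const_mul] at h
    rw [h]
    have h0 : (m : ℝ) * besselJ m 0 = 0 := by
      rcases eq_or_ne m 0 with rfl | hm
      · simp
      · rw [besselJ_zero_arg hm, mul_zero]
    simp only [mul_one, mul_zero, hz]
    linear_combination (m / 2 * besselJ m 0 : ℝ) * h0
  · intro s hs
    have hu := hasDerivAt_comp_mul_of_differentiable (differentiable_besselJ m) z s
    have hu' := hasDerivAt_comp_mul_of_differentiable (differentiable_deriv_besselJ m) z s
    have hs1 := (hasDerivAt_id s).const_mul z
    have h := (((hs1.mul hu').pow 2).add (((hs1.pow 2).sub_const ((m : ℝ) ^ 2)).mul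
      (hu.pow 2))).div_const 2
    refine h.congr_deriv ?_
    have o1 := besselJ_ode m (z * s)
    simp only [id, Pi.mul_apply, Pi.pow_apply, Nat.cast_ofNat, Nat.add_one_sub_one, pow_one,
      mul_one]
    linear_combination (z * deriv (besselJ m) (z * s)) * o1

/-- The Lommel integral at a zero `z` of `J_m`; the removable singularity of the quotient at
`κ = z` accounts for the normalization integral. -/
lemma integral_besselJ_mul_besselJ_of_zero (m : ℤ) {z κ : ℝ} (hz0 : 0 < z) (hκ : 0 ≤ κ)
    (hz : besselJ m z = 0) :
    ∫ s in (0 : ℝ)..1, s * (besselJ m (z * s) * besselJ m (κ * s)) =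
      z * deriv (besselJ m) z * besselQuotient m z κ := by
  unfold besselQuotient
  split_ifs with h
  · subst h
    have := integral_besselJ_sq m hz
    apply mul_left_cancel₀ (pow_ne_zero 2 hz0.ne')
    rw [this]
    field_simp
  · have hne : κ ^ 2 - z ^ 2 ≠ 0 := by
      rw [sub_ne_zero]
      exact fun h' => h ((pow_left_inj₀ hκ hz0.le two_ne_zero).1 h')
    have := integral_besselJ_mul_besselJ m z κ
    rw [hz] at this
    rw [← mul_div_assoc, eq_div_iff hne]
    linear_combination -this

/-! ### The positive zeros -/

lemma deriv_besselJ_ne_zero (m : ℕ) {z : ℝ} (hz0 : 0 < z) (hz : besselJ m z = 0) :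
    deriv (besselJ m) z ≠ 0 := by
  intro hd
  have h := integral_besselJ_mul_besselJ_of_zero m hz0 hz0.le hz
  rw [hd, mul_zero, zero_mul] at h
  obtain ⟨δ, hδ, hpos⟩ := besselJ_pos_near_zero m
  -- At a double zero the normalization integral would vanish, although `J_m > 0` near `0`.
  have hc : Continuous fun s : ℝ => s * (besselJ m (z * s) * besselJ m (z * s)) := by fun_prop
  have hlt : 0 < ∫ s in (0 : ℝ)..1, s * (besselJ m (z * s) * besselJ m (z * s)) := by
    refine intervalIntegral.integral_pos one_pos hc.continuousOn
      (fun s hs => mul_nonneg hs.1.le (mul_self_nonneg _)) ⟨min 1 (δ / (2 * z)), ?_, ?_⟩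
    · exact ⟨by positivity, min_le_left _ _⟩
    · have h1 : 0 < min 1 (δ / (2 * z)) := by positivity
      have h2 := hpos (z * min 1 (δ / (2 * z))) (by positivity) (by
        calc z * min 1 (δ / (2 * z)) ≤ z * (δ / (2 * z)) := by gcongr; exact min_le_right _ _
          _ = δ / 2 := by field_simp
          _ < δ := half_lt_self hδ)
      positivity
  exact hlt.ne' h

/-- Sturm comparison of `√x J_m(x)` with `sin((x - y) / 2)`: the Wronskian of these two functions
is increasing as long as `J_m` is positive, but changes sign from `y` to `y + 2π`. -/
lemma not_forall_besselJ_pos (m : ℤ) (c : ℝ) {y : ℝ} (hy : 0 < y) (hm : 2 * |(m : ℝ)| ≤ y) :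
    ¬ ∀ x ∈ Set.Icc y (y + 2 * Real.pi), 0 < c * besselJ m x := by
  intro hpos
  set W : ℝ → ℝ := fun x => c * (√x * (besselJ m x * (Real.cos ((x - y) / 2) / 2) -
    deriv (besselJ m) x * Real.sin ((x - y) / 2)) -
    besselJ m x * Real.sin ((x - y) / 2) / (2 * √x)) with hW
  have hder : ∀ x, 0 < x → HasDerivAt W (c * besselJ m x * Real.sin ((x - y) / 2) *
      (3 / 4 * x ^ 2 - m ^ 2 + 1 / 4) / √x ^ 3) x := by
    intro x hx
    have hr := Real.hasDerivAt_sqrt hx.ne'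
    have hr0 : √x ≠ 0 := (Real.sqrt_pos.2 hx).ne'
    have hl : HasDerivAt (fun x => (x - y) / 2) (1 / 2) x :=
      ((hasDerivAt_id x).sub_const y).div_const 2
    have hJ := hasDerivAt_besselJ_deriv m x
    have hJ' := (differentiable_deriv_besselJ m x).hasDerivAt
    have h := ((hr.mul ((hJ.mul (hl.cos.div_const 2)).sub (hJ'.mul hl.sin))).sub
      ((hJ.mul hl.sin).div (hr.const_mul 2) (mul_ne_zero two_ne_zero hr0))).const_mul c
    refine h.congr_deriv ?_
    have o := besselJ_ode m x
    have hx2 : √x ^ 2 = x := Real.sq_sqrt hx.le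
    simp only [Pi.mul_apply, Pi.sub_apply]
    generalize √x = r at *
    subst hx2
    field_simp
    linear_combination (-16 * c * Real.sin ((r ^ 2 - y) / 2)) * o
  have hmono : MonotoneOn W (Set.Icc y (y + 2 * Real.pi)) := by
    refine monotoneOn_of_deriv_nonneg (convex_Icc _ _)
      (fun x hx => (hder x (hy.trans_le hx.1)).continuousAt.continuousWithinAt)
      (fun x hx => ?_) fun x hx => ?_
    · rw [interior_Icc] at hx
      exact (hder x (hy.trans hx.1)).differentiableAt.differentiableWithinAt
    · rw [interior_Icc] at hx
      have hx0 := hy.trans hx.1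
      rw [(hder x hx0).deriv]
      have h1 : 0 ≤ Real.sin ((x - y) / 2) :=
        Real.sin_nonneg_of_nonneg_of_le_pi (by linarith [hx.1]) (by linarith [hx.2])
      have h2 := hpos x (Set.Ioo_subset_Icc_self hx)
      have h3 : (m : ℝ) ^ 2 ≤ (x / 2) ^ 2 := by
        rw [← sq_abs (m : ℝ)]
        exact pow_le_pow_left₀ (abs_nonneg _) (by linarith [hx.1]) 2
      have h4 : 0 ≤ 3 / 4 * x ^ 2 - m ^ 2 + 1 / 4 := by nlinarith
      positivity
  have hpi := Real.pi_pos
  have h := hmono ⟨le_rfl, by linarith⟩ ⟨by linarith, le_rfl⟩ (by linarith)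
  have e : (y + 2 * Real.pi - y) / 2 = Real.pi := by ring
  simp only [hW, e, sub_self, zero_div, Real.sin_zero, Real.cos_zero, Real.sin_pi, Real.cos_pi,
    mul_zero, sub_zero] at h
  have h1 := hpos y ⟨le_rfl, by linarith⟩
  have h2 := hpos (y + 2 * Real.pi) ⟨by linarith, le_rfl⟩
  have h3 : 0 < √y * (c * besselJ m y) := mul_pos (Real.sqrt_pos.2 hy) h1
  have h4 : 0 < √(y + 2 * Real.pi) * (c * besselJ m (y + 2 * Real.pi)) :=
    mul_pos (Real.sqrt_pos.2 (by linarith)) h2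
  linarith

lemma exists_mem_Icc_zero_of_mul_nonpos {f : ℝ → ℝ} (hf : Continuous f) {p q : ℝ} (hpq : p ≤ q)
    (hp : 0 < f p) (hq : f q ≤ 0) : ∃ x ∈ Set.Icc p q, f x = 0 :=
  intermediate_value_Icc' hpq hf.continuousOn ⟨hq, hp.le⟩

/-- `J_m` has arbitrarily large zeros. -/
lemma exists_besselJ_zero_gt (m : ℤ) (X : ℝ) : ∃ x, X < x ∧ besselJ m x = 0 := by
  by_contra! hne
  set y := max X 0 + 2 * |(m : ℝ)| + 1 with hy
  have hXy : X < y := by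
    have := le_max_left X 0
    have := abs_nonneg (m : ℝ)
    linarith
  have hy0 : 0 < y := by positivity
  refine not_forall_besselJ_pos m (besselJ m y) hy0
    (by linarith [le_max_right X 0]) fun x hx => ?_
  by_contra! hx0
  obtain ⟨w, hw, hw0⟩ := exists_mem_Icc_zero_of_mul_nonpos
    (f := fun x => besselJ m y * besselJ m x) (by fun_prop) hx.1
    (mul_self_pos.2 (hne y hXy)) hx0
  rcases mul_eq_zero.1 hw0 with h | h
  · exact hne y hXy h
  · exact hne w (hXy.trans_le hw.1) h

/-- Successive zeros are well defined, simple, and the sign of `J_m` alternates: `(-1) ^ n J_m` is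
positive just to the right of `z_{mn}`. -/
lemma besselZero_spec (m n : ℕ) :
    0 ≤ besselZero m n ∧
    (1 ≤ n → 0 < besselZero m n ∧ besselJ m (besselZero m n) = 0 ∧
      0 < (-1) ^ n * deriv (besselJ m) (besselZero m n)) ∧
    ∃ δ > 0, ∀ x, besselZero m n < x → x < besselZero m n + δ → 0 < (-1) ^ n * besselJ m x := by
  induction n with
  | zero =>
    obtain ⟨δ, hδ, h⟩ := besselJ_pos_near_zero m
    refine ⟨le_rfl, fun h => absurd h (by norm_num), δ, hδ, fun x h0 h1 => ?_⟩
    simp only [besselZero, zero_add, pow_zero, one_mul] at h0 h1 ⊢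
    exact h x h0 h1
  | succ n ih =>
    obtain ⟨hz0, -, δ, hδ, hpos⟩ := ih
    set y := besselZero m n with hy
    set z := besselZero m (n + 1) with hz
    set g : ℝ → ℝ := fun x => (-1) ^ n * besselJ m x with hg
    have hgc : Continuous g := by fun_prop
    have hg0 : ∀ x, g x = 0 ↔ besselJ m x = 0 := fun x => by simp [hg]
    -- Since `J_m` has no zero just beyond `y`, the set of later zeros is closed and contains its
    -- infimum.
    have hS : {x : ℝ | y < x ∧ besselJ m x = 0} = Set.Ici (y + δ) ∩ besselJ m ⁻¹' {0} := by
      ext x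
      simp only [Set.mem_ofPred_eq, Set.mem_inter_iff, Set.mem_Ici, Set.mem_preimage,
        Set.mem_singleton_iff]
      refine ⟨fun h => ⟨?_, h.2⟩, fun h => ⟨by linarith [h.1], h.2⟩⟩
      by_contra! hlt
      exact (hpos x h.1 hlt).ne' ((hg0 x).2 h.2)
    have hbdd : BddBelow {x : ℝ | y < x ∧ besselJ m x = 0} := ⟨y, fun x hx => hx.1.le⟩
    have hzS : z ∈ {x : ℝ | y < x ∧ besselJ m x = 0} := by
      refine IsClosed.csInf_mem ?_ (exists_besselJ_zero_gt m y) hbdd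
      rw [hS]
      exact isClosed_Ici.inter (isClosed_singleton.preimage (continuous_besselJ m))
    have hzpos : 0 < z := hz0.trans_lt hzS.1
    -- The sign of `J_m` just beyond `y` persists up to the next zero `z`.
    have hgpos : ∀ x, y < x → x < z → 0 < g x := by
      intro x h0 h1
      by_contra! hx
      have hp1 : y < min x (y + δ / 2) := lt_min h0 (by linarith)
      obtain ⟨w, hw, hw0⟩ := exists_mem_Icc_zero_of_mul_nonpos hgc (min_le_left x (y + δ / 2))
        (hpos _ hp1 ((min_le_right _ _).trans_lt (by linarith))) hx
      exact notMem_of_lt_csInf (hw.2.trans_lt h1) hbdd ⟨hp1.trans_le hw.1, (hg0 w).1 hw0⟩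
    have hgz : g z = 0 := (hg0 z).2 hzS.2
    have hgd : deriv g z = (-1) ^ n * deriv (besselJ m) z :=
      ((hasDerivAt_besselJ_deriv m z).const_mul _).deriv
    have hgd0 : deriv g z ≠ 0 := by
      rw [hgd]
      exact mul_ne_zero (by simp) (deriv_besselJ_ne_zero m hzpos hzS.2)
    have hneg : deriv g z < 0 := by
      refine lt_of_le_of_ne (not_lt.1 fun hlt => ?_) hgd0
      have h1 := (eventually_nhdsWithin_sign_eq_of_deriv_pos hlt hgz).filter_mono
        (nhdsWithin_le_nhds (s := Set.Iio z))
      have h2 : ∀ᶠ x in nhdsWithin z (Set.Iio z), x ∈ Set.Ioo y z := Ioo_mem_nhdsLT hzS.1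
      obtain ⟨x, hx, hxm⟩ := (h1.and h2).exists
      rw [sign_pos (hgpos x hxm.1 hxm.2), sign_neg (sub_neg.2 hxm.2)] at hx
      exact absurd hx (by decide)
    refine ⟨hzpos.le, fun _ => ⟨hzpos, hzS.2, ?_⟩, ?_⟩
    · rw [pow_succ]
      linarith
    · have h1 := eventually_nhdsWithin_sign_eq_of_deriv_neg hneg hgz
      obtain ⟨ε, hε, h⟩ := Metric.eventually_nhds_iff.1 h1
      refine ⟨ε, hε, fun x h0 h1 => ?_⟩
      have hx := h (y := x) (by rw [Real.dist_eq, abs_of_pos (sub_pos.2 h0)]; linarith)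
      rw [sign_neg (sub_neg.2 h0), sign_eq_neg_one_iff] at hx
      rw [pow_succ]
      simp only [hg] at hx
      linarith

lemma besselJ_neg_eq (m : ℤ) : besselJ (-m) = fun x => (-1) ^ m.natAbs * besselJ m x :=
  funext (besselJ_neg m)

lemma besselZero_neg (m : ℤ) (n : ℕ) : besselZero (-m) n = besselZero m n := by
  induction n with
  | zero => rfl
  | succ n ih => simp [besselZero, ih, besselJ_neg]

/-- The sign of `J_m'` at the positive zeros, for all integers `m`. The sign `ε` is the ratio of
`i ^ m` and `i ^ |m|`. -/
lemma exists_sign_deriv_besselJ (m : ℤ) {n : ℕ} (hn : 1 ≤ n) :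
    0 < besselZero m n ∧ besselJ m (besselZero m n) = 0 ∧
    ∃ ε : ℝ, ε * ε = 1 ∧ Complex.I ^ m = (ε : ℂ) * Complex.I ^ m.natAbs ∧
      0 < (-1) ^ n * ε * deriv (besselJ m) (besselZero m n) := by
  obtain ⟨k, rfl | rfl⟩ := m.eq_nat_or_neg
  · obtain ⟨h1, h2, h3⟩ := (besselZero_spec k n).2.1 hn
    exact ⟨h1, h2, 1, by norm_num, by simp, by simpa using h3⟩
  · obtain ⟨h1, h2, h3⟩ := (besselZero_spec k n).2.1 hn
    have hsq : ((-1 : ℝ) ^ k) * (-1) ^ k = 1 := by rw [← mul_pow]; simp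
    rw [besselZero_neg, besselJ_neg_eq]
    refine ⟨h1, by simp [h2], (-1) ^ k, hsq, ?_, ?_⟩
    · rw [Int.natAbs_neg, Int.natAbs_natCast, zpow_neg, zpow_natCast, ← inv_pow, Complex.inv_I]
      push_cast
      rw [← mul_pow, neg_one_mul]
    · rw [((hasDerivAt_besselJ_deriv k _).const_mul _).deriv, Int.natAbs_natCast]
      calc (0 : ℝ) < _ := h3
        _ = (-1) ^ n * (((-1 : ℝ) ^ k) * (-1) ^ k) * deriv (besselJ k) (besselZero k n) := by
          rw [hsq, mul_one]
        _ = _ := by ring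

/-! ### Plane waves in polar coordinates -/

/-- Bessel's integral in complex form, over a full period. -/
lemma integral_exp_eq_besselJ (m : ℤ) (x : ℝ) :
    ∫ t in (-Real.pi)..Real.pi, Complex.exp (Complex.I * (m * t - x * Real.sin t : ℝ)) =
      2 * Real.pi * besselJ m x := by
  set h : ℝ → ℂ := fun t => Complex.exp (Complex.I * (m * t - x * Real.sin t : ℝ)) with hh
  have hc : Continuous h := by fun_prop
  have h1 := intervalIntegral.integral_add_adjacent_intervals
    (hc.intervalIntegrable (μ := volume) (-Real.pi) 0) (hc.intervalIntegrable 0 Real.pi)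
  have h2 := intervalIntegral.integral_comp_neg h (a := 0) (b := Real.pi)
  rw [neg_zero] at h2
  have hc' : Continuous fun t => h (-t) := hc.comp continuous_neg
  rw [← h1, ← h2, ← intervalIntegral.integral_add (hc'.intervalIntegrable _ _)
    (hc.intervalIntegrable _ _)]
  have h3 : ∀ t : ℝ, h (-t) + h t = 2 * ((Real.cos (m * t - x * Real.sin t) : ℝ) : ℂ) := by
    intro t
    simp only [hh]
    rw [Complex.ofReal_cos, Complex.two_cos]
    rw [add_comm]
    congr 2
    · ring
    · rw [Real.sin_neg]
      push_cast
      ring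
  simp only [h3]
  rw [intervalIntegral.integral_const_mul, intervalIntegral.integral_ofReal]
  unfold besselJ
  have := Real.pi_ne_zero
  push_cast
  field_simp

/-- The angular Fourier coefficients of a plane wave (Jacobi–Anger). -/
lemma integral_exp_mul_planeWave (m : ℤ) (x φ : ℝ) :
    ∫ θ in (0 : ℝ)..(2 * Real.pi), Complex.exp (Complex.I * m * θ) *
      Complex.exp (-(Complex.I * (x * Real.cos (θ - φ) : ℝ))) =
      2 * Real.pi * (-Complex.I) ^ m * besselJ m x * Complex.exp (Complex.I * m * φ) := by
  set h : ℝ → ℂ := fun θ => Complex.exp (Complex.I * m * θ) *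
      Complex.exp (-(Complex.I * (x * Real.cos (θ - φ) : ℝ))) with hh
  have hper : Function.Periodic h (2 * Real.pi) := by
    intro θ
    simp only [hh]
    congr 1
    · rw [show Complex.I * m * ((θ + 2 * Real.pi : ℝ) : ℂ) =
        Complex.I * m * θ + m * (2 * Real.pi * Complex.I) by push_cast; ring]
      exact Complex.exp_periodic.int_mul m _
    · rw [show θ + 2 * Real.pi - φ = (θ - φ) + 2 * Real.pi by ring, Real.cos_add_two_pi]
  have h1 := hper.intervalIntegral_add_eq 0 (-Real.pi + (φ - Real.pi / 2))
  rw [zero_add, show -Real.pi + (φ - Real.pi / 2) + 2 * Real.pi =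
    Real.pi + (φ - Real.pi / 2) by ring, ← intervalIntegral.integral_comp_add_right] at h1
  rw [h1]
  have hI : (-Complex.I) ^ m = Complex.exp (m * (-Real.pi / 2 * Complex.I)) := by
    rw [Complex.exp_int_mul, Complex.exp_neg_pi_div_two_mul_I]
  have h2 : ∀ t : ℝ, h (t + (φ - Real.pi / 2)) =
      (-Complex.I) ^ m * Complex.exp (Complex.I * m * φ) *
        Complex.exp (Complex.I * (m * t - x * Real.sin t : ℝ)) := by
    intro t
    simp only [hh]
    rw [show t + (φ - Real.pi / 2) - φ = t - Real.pi / 2 by ring, Real.cos_sub_pi_div_two, hI,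
      ← Complex.exp_add, ← Complex.exp_add, ← Complex.exp_add]
    congr 1
    push_cast
    ring
  simp only [h2]
  rw [intervalIntegral.integral_const_mul, integral_exp_eq_besselJ]
  ring

lemma norm_mk_eq_norm (x : Plane) : ‖Complex.mk (x 0) (x 1)‖ = ‖x‖ := by
  rw [EuclideanSpace.norm_eq, Fin.sum_univ_two, Complex.norm_def, Complex.normSq_apply]
  simp [sq]

lemma polarAngle_eq (x : Plane) :
    ∃ j : ℤ, polarAngle x = Complex.arg (Complex.mk (x 0) (x 1)) - j * (2 * Real.pi) := by
  refine ⟨toIcoDiv Real.two_pi_pos 0 (Complex.arg (Complex.mk (x 0) (x 1))), ?_⟩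
  rw [polarAngle, toIcoMod, zsmul_eq_mul]

lemma norm_mul_cos_polarAngle (x : Plane) : ‖x‖ * Real.cos (polarAngle x) = x 0 := by
  obtain ⟨j, hj⟩ := polarAngle_eq x
  rw [hj, Real.cos_sub_int_mul_two_pi, ← norm_mk_eq_norm, Complex.norm_mul_cos_arg]

lemma norm_mul_sin_polarAngle (x : Plane) : ‖x‖ * Real.sin (polarAngle x) = x 1 := by
  obtain ⟨j, hj⟩ := polarAngle_eq x
  rw [hj, Real.sin_sub_int_mul_two_pi, ← norm_mk_eq_norm, Complex.norm_mul_sin_arg]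

@[simp] lemma polarPoint_zero (r θ : ℝ) : polarPoint r θ 0 = r * Real.cos θ := rfl

@[simp] lemma polarPoint_one (r θ : ℝ) : polarPoint r θ 1 = r * Real.sin θ := rfl

lemma norm_polarPoint {r : ℝ} (hr : 0 ≤ r) (θ : ℝ) : ‖polarPoint r θ‖ = r := by
  rw [EuclideanSpace.norm_eq, Fin.sum_univ_two]
  simp only [polarPoint_zero, polarPoint_one, Real.norm_eq_abs, sq_abs]
  rw [show (r * Real.cos θ) ^ 2 + (r * Real.sin θ) ^ 2 = r ^ 2 by
    linear_combination r ^ 2 * Real.sin_sq_add_cos_sq θ, Real.sqrt_sq hr]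

/-! ### Integration in polar coordinates -/

/-- The coordinate pair of a point of the plane, as a measurable equivalence. -/
def planeEquivProd : Plane ≃ᵐ ℝ × ℝ :=
  (MeasurableEquiv.toLp 2 (Fin 2 → ℝ)).symm.trans MeasurableEquiv.finTwoArrow

lemma measurePreserving_planeEquivProd : MeasurePreserving planeEquivProd :=
  (volume_preserving_finTwoArrow ℝ).comp
    (EuclideanSpace.volume_preserving_symm_measurableEquiv_toLp (Fin 2))

lemma planeEquivProd_symm_polarCoord_symm (p : ℝ × ℝ) :
    planeEquivProd.symm (polarCoord.symm p) = polarPoint p.1 p.2 := by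
  apply planeEquivProd.injective
  rw [MeasurableEquiv.apply_symm_apply]
  rfl

lemma polarPoint_add_two_pi (r θ : ℝ) : polarPoint r (θ + 2 * Real.pi) = polarPoint r θ := by
  simp [polarPoint]

/-- Integration in polar coordinates, for an integrable function supported in a disk. -/
lemma integral_eq_integral_polarPoint {R : ℝ} (hR : 0 ≤ R) {h : Plane → ℂ} (hi : Integrable h)
    (hs : ∀ x, R < ‖x‖ → h x = 0) :
    ∫ x, h x = ∫ r in (0 : ℝ)..R, ∫ θ in (0 : ℝ)..(2 * Real.pi), h (polarPoint r θ) * (r : ℂ) := by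
  set h' : ℝ × ℝ → ℂ := fun p => h (planeEquivProd.symm p) with hh'
  have hi' : Integrable h' :=
    measurePreserving_planeEquivProd.symm.integrable_comp_of_integrable hi
  have e1 : ∫ x, h x = ∫ p, h' p :=
    (measurePreserving_planeEquivProd.symm.integral_comp' h).symm
  have hi2 : IntegrableOn (fun p : ℝ × ℝ => |p.1| • h' (polarCoord.symm p)) polarCoord.target := by
    have := (integrableOn_image_iff_integrableOn_abs_det_fderiv_smul volume
      polarCoord.open_target.measurableSet
      (fun p _ => (hasFDerivAt_polarCoord_symm p).hasFDerivWithinAt)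
      polarCoord.symm.injOn h').1 hi'.integrableOn
    simpa only [det_fderivPolarCoordSymm] using this
  have hi3 : IntegrableOn (fun p : ℝ × ℝ => h (polarPoint p.1 p.2) * (p.1 : ℂ))
      (Set.Ioi (0 : ℝ) ×ˢ Set.Ioo (-Real.pi) Real.pi) := by
    refine hi2.congr_fun (fun p hp => ?_) polarCoord.open_target.measurableSet
    simp only [hh', planeEquivProd_symm_polarCoord_symm]
    rw [abs_of_pos hp.1, Complex.real_smul, mul_comm]
  rw [e1, ← integral_comp_polarCoord_symm]
  have e2 : ∫ p in polarCoord.target, p.1 • h' (polarCoord.symm p) =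
      ∫ p in Set.Ioi (0 : ℝ) ×ˢ Set.Ioo (-Real.pi) Real.pi,
        h (polarPoint p.1 p.2) * (p.1 : ℂ) := by
    refine setIntegral_congr_fun polarCoord.open_target.measurableSet fun p _ => ?_
    simp only [hh', planeEquivProd_symm_polarCoord_symm]
    rw [Complex.real_smul, mul_comm]
  rw [e2, Measure.volume_eq_prod, setIntegral_prod _ hi3]
  have e3 : ∀ r : ℝ, ∫ θ in Set.Ioo (-Real.pi) Real.pi, h (polarPoint r θ) * (r : ℂ) =
      ∫ θ in (0 : ℝ)..(2 * Real.pi), h (polarPoint r θ) * (r : ℂ) := by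
    intro r
    have hper : Function.Periodic (fun θ => h (polarPoint r θ) * (r : ℂ)) (2 * Real.pi) :=
      fun θ => by simp only [polarPoint_add_two_pi]
    have := hper.intervalIntegral_add_eq (-Real.pi) 0
    rw [zero_add, show -Real.pi + 2 * Real.pi = Real.pi by ring] at this
    rw [← this, intervalIntegral.integral_of_le (by linarith [Real.pi_pos]),
      integral_Ioc_eq_integral_Ioo]
  simp only [e3]
  rw [intervalIntegral.integral_of_le hR]
  refine setIntegral_eq_of_subset_of_forall_sdiff_eq_zero measurableSet_Ioi
    Set.Ioc_subset_Ioi_self fun r hr => ?_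
  have hr1 : R < r := not_le.1 fun h' => hr.2 ⟨hr.1, h'⟩
  have : ∀ θ, h (polarPoint r θ) = 0 := fun θ => hs _ (by rwa [norm_polarPoint hr.1.le])
  simp [this]

/-! ### Parseval's identity on a square -/

/-- The Fourier integral `∫ h(x) exp(-π i ω·x) dx` over the plane. -/
noncomputable def planeFourier (h : Plane → ℂ) (ω : Plane) : ℂ :=
  ∫ x, h x * Complex.exp (-(Real.pi * Complex.I * ((ω 0 * x 0 + ω 1 * x 1 : ℝ) : ℂ)))

/-- The half-open unit cube centred at the origin. -/
def centredCube : Set (Fin 2 → ℝ) := {y | ∀ i, y i ∈ Set.Ioc (-1 / 2 : ℝ) (-1 / 2 + 1)}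

lemma measurableSet_centredCube : MeasurableSet centredCube :=
  MeasurableSet.univ_pi' fun _ => measurableSet_Ioc

/-- The dilation carrying the centred unit cube to the square of side `2 a`. -/
noncomputable def cubeDilation (a : ℝ) (y : Fin 2 → ℝ) : Plane := (2 * a) • WithLp.toLp 2 y

lemma cubeDilation_apply (a : ℝ) (y : Fin 2 → ℝ) (i : Fin 2) :
    cubeDilation a y i = 2 * a * y i := rfl

lemma centredCube_ae_eq : centredCube =ᵐ[volume] Set.Icc (fun _ => -1 / 2) (fun _ => 1 / 2) := by
  have h := Measure.univ_pi_Ioc_ae_eq_Icc (ι := Fin 2) (μ := fun _ => (volume : Measure ℝ))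
    (f := fun _ => -1 / 2) (g := fun _ => 1 / 2)
  have e : centredCube = Set.univ.pi fun _ => Set.Ioc (-1 / 2 : ℝ) (1 / 2) := by
    ext y
    simp only [centredCube, Set.mem_ofPred_eq, Set.mem_univ_pi]
    norm_num
  rw [volume_pi, e]
  exact h

/-- Integrals over the unit cube of a dilated function supported in the disk of radius `a`, which
the square of side `2 a` contains up to a null set. -/
lemma integral_centredCube {a : ℝ} (ha : 0 < a) {ψ : Plane → ℂ} (hs : ∀ x, a < ‖x‖ → ψ x = 0) :
    ∫ y in centredCube, ψ (cubeDilation a y) = ((4 * a ^ 2 : ℝ) : ℂ)⁻¹ * ∫ x, ψ x := by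
  rw [setIntegral_congr_set centredCube_ae_eq]
  have h1 : ∫ y in Set.Icc (fun _ : Fin 2 => (-1 / 2 : ℝ)) (fun _ => 1 / 2),
      ψ (cubeDilation a y) = ∫ y, ψ (cubeDilation a y) := by
    refine setIntegral_eq_integral_of_forall_compl_eq_zero fun y hy => hs _ ?_
    by_contra! hle
    refine hy ?_
    have hi : ∀ i, |y i| ≤ 1 / 2 := by
      intro i
      have := (PiLp.norm_apply_le (cubeDilation a y) i).trans hle
      rw [cubeDilation_apply, Real.norm_eq_abs, abs_mul, abs_of_pos (by positivity)] at this
      have h2 : a * (2 * |y i|) ≤ a * 1 := by linarith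
      linarith [le_of_mul_le_mul_left h2 ha]
    exact ⟨fun i => by linarith [(abs_le.1 (hi i)).1], fun i => (abs_le.1 (hi i)).2⟩
  have h2 : ∫ y, ψ (cubeDilation a y) = ∫ x : Plane, ψ ((2 * a) • x) :=
    (EuclideanSpace.volume_preserving_symm_measurableEquiv_toLp (Fin 2)).symm.integral_comp'
      (fun x : Plane => ψ ((2 * a) • x))
  rw [h1, h2, Measure.integral_comp_smul, finrank_euclideanSpace, Fintype.card_fin,
    abs_of_nonneg (by positivity), Complex.real_smul, Complex.ofReal_inv]
  congr 3
  ring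

lemma memLp_comp_cubeDilation {a : ℝ} (ha : 0 < a) {h : Plane → ℂ} (hh : MemLp h 2) :
    MemLp (fun y => h (cubeDilation a y)) 2 := by
  have h1 : MemLp (fun x : Plane => h ((2 * a) • x)) 2 := by
    have hm : MemLp h 2 (Measure.map (fun x : Plane => (2 * a) • x) volume) := by
      rw [Measure.map_addHaar_smul _ (by positivity)]
      exact hh.smul_measure ENNReal.ofReal_ne_top
    exact hm.comp_of_map (by fun_prop)
  exact h1.comp_measurePreserving
    (EuclideanSpace.volume_preserving_symm_measurableEquiv_toLp (Fin 2)).symm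

section Torus

-- The probability Haar measure on the circle, with respect to which Fourier coefficients on the
-- torus are defined.
attribute [local instance] instMeasureSpaceUnitAddCircle

/-- The function on the torus obtained from the restriction of `h` to the square of side `2 a`
by periodization. -/
noncomputable def torusLift (a : ℝ) (h : Plane → ℂ) (t : UnitAddTorus (Fin 2)) : ℂ :=
  h (cubeDilation a (UnitAddTorus.measurableEquivPiIoc (fun _ => -1 / 2) t).1)

lemma torusLift_coe (a : ℝ) (h : Plane → ℂ) {y : Fin 2 → ℝ} (hy : y ∈ centredCube) :
    torusLift a h (fun i => (y i : UnitAddCircle)) = h (cubeDilation a y) := by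
  unfold torusLift
  congr 2
  funext i
  rw [UnitAddTorus.coe_measurableEquivPiIoc_apply]
  exact congrArg Subtype.val (AddCircle.equivIoc_coe_eq (hy i))

lemma memLp_torusLift {a : ℝ} (ha : 0 < a) {h : Plane → ℂ} (hh : MemLp h 2) :
    MemLp (torusLift a h) 2 := by
  have h1 := ((memLp_comp_cubeDilation ha hh).restrict centredCube).comp_measurePreserving
    (measurePreserving_subtype_coe measurableSet_centredCube)
  exact h1.comp_measurePreserving (UnitAddTorus.measurePreserving_equivPiIoc (fun _ => -1 / 2))

lemma mFourierCoeff_torusLift {a : ℝ} (ha : 0 < a) {h : Plane → ℂ}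
    (hs : ∀ x, a < ‖x‖ → h x = 0) (k : ℤ × ℤ) :
    UnitAddTorus.mFourierCoeff (torusLift a h) ((finTwoArrowEquiv ℤ).symm k) =
      ((4 * a ^ 2 : ℝ) : ℂ)⁻¹ * planeFourier h (a⁻¹ • latticePoint k) := by
  rw [UnitAddTorus.mFourierCoeff_eq_integral _ _ (fun _ => -1 / 2), planeFourier,
    ← integral_centredCube ha fun x hx => by rw [hs x hx, zero_mul]]
  refine setIntegral_congr_fun measurableSet_centredCube fun y hy => ?_
  simp only
  rw [torusLift_coe a h hy, smul_eq_mul, mul_comm]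
  congr 1
  simp only [UnitAddTorus.mFourier, ContinuousMap.coe_mk, Fin.prod_univ_two, fourier_coe_apply,
    ← Complex.exp_add, PiLp.smul_apply, cubeDilation_apply]
  congr 1
  have ha' : (a : ℂ) ≠ 0 := by exact_mod_cast ha.ne'
  simp [latticePoint]
  field_simp
  ring

/-- Parseval's identity on the square of side `2 a`, for functions supported in the inscribed
disk. -/
lemma hasSum_planeFourier {a : ℝ} (ha : 0 < a) {g h : Plane → ℂ} (hg : MemLp g 2)
    (hh : MemLp h 2) (hgs : ∀ x, a < ‖x‖ → g x = 0) (hhs : ∀ x, a < ‖x‖ → h x = 0) :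
    HasSum (fun k : ℤ × ℤ => ((4 * a ^ 2 : ℝ) : ℂ)⁻¹ *
        (starRingEnd ℂ) (planeFourier g (a⁻¹ • latticePoint k)) *
        planeFourier h (a⁻¹ • latticePoint k))
      (∫ x, (starRingEnd ℂ) (g x) * h x) := by
  have hG := memLp_torusLift ha hg
  have hH := memLp_torusLift ha hh
  have key := UnitAddTorus.hasSum_prod_mFourierCoeff (hG.toLp _) (hH.toLp _)
  have c1 : ∀ {f : UnitAddTorus (Fin 2) → ℂ} (hf : MemLp f 2) (n : Fin 2 → ℤ),
      UnitAddTorus.mFourierCoeff (hf.toLp _) n = UnitAddTorus.mFourierCoeff f n := fun hf n =>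
    integral_congr_ae (hf.coeFn_toLp.mono fun t ht => by simp only [ht])
  have c2 : ∫ t, (starRingEnd ℂ) (hG.toLp _ t) * hH.toLp _ t =
      ((4 * a ^ 2 : ℝ) : ℂ)⁻¹ * ∫ x, (starRingEnd ℂ) (g x) * h x := by
    rw [← integral_centredCube ha fun x hx => by rw [hhs x hx, mul_zero]]
    trans ∫ t, (starRingEnd ℂ) (torusLift a g t) * torusLift a h t
    · refine integral_congr_ae ?_
      filter_upwards [hG.coeFn_toLp, hH.coeFn_toLp] with t h1 h2
      rw [h1, h2]
    · rw [UnitAddTorus.integral_preimage _ (fun _ => -1 / 2)]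
      refine setIntegral_congr_fun measurableSet_centredCube fun y hy => ?_
      simp only [torusLift_coe a _ hy]
  simp only [c1, c2] at key
  rw [← (finTwoArrowEquiv ℤ).symm.hasSum_iff] at key
  have ha' : ((4 * a ^ 2 : ℝ) : ℂ) ≠ 0 := by exact_mod_cast (by positivity : 4 * a ^ 2 ≠ 0)
  have key2 := key.mul_left ((4 * a ^ 2 : ℝ) : ℂ)
  rw [mul_inv_cancel_left₀ ha'] at key2
  refine key2.congr_fun fun k => ?_
  simp only [Function.comp_apply, mFourierCoeff_torusLift ha hgs, mFourierCoeff_torusLift ha hhs,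
    map_mul, map_inv₀, Complex.conj_ofReal]
  field_simp

end Torus

/-! ### The zero-padded convolution -/

lemma memLp_zeroPad {b : ℝ} {f : Plane → ℂ}
    (hf : MemLp f 2 (volume.restrict (Metric.closedBall (0 : Plane) b))) :
    MemLp (zeroPad b f) 2 :=
  (memLp_indicator_iff_restrict measurableSet_closedBall).2 hf

lemma integrable_zeroPad {b : ℝ} {f : Plane → ℂ}
    (hf : MemLp f 2 (volume.restrict (Metric.closedBall (0 : Plane) b))) :
    Integrable (zeroPad b f) := by
  have : IsFiniteMeasure (volume.restrict (Metric.closedBall (0 : Plane) b)) :=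
    ⟨by rw [Measure.restrict_apply_univ]; exact measure_closedBall_lt_top⟩
  exact (integrable_indicator_iff measurableSet_closedBall).2 (hf.integrable one_le_two)

lemma zeroPad_of_lt {b : ℝ} (f : Plane → ℂ) {x : Plane} (hx : b < ‖x‖) : zeroPad b f x = 0 :=
  Set.indicator_of_notMem (by simpa using hx) f

lemma zeroPad_of_le {b : ℝ} (f : Plane → ℂ) {x : Plane} (hx : ‖x‖ ≤ b) : zeroPad b f x = f x :=
  Set.indicator_of_mem (by simpa using hx) f

lemma continuous_planeWave (ω : Plane) : Continuous fun x : Plane =>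
    Complex.exp (-(Real.pi * Complex.I * ((ω 0 * x 0 + ω 1 * x 1 : ℝ) : ℂ))) := by
  fun_prop

lemma norm_planeWave (ω x : Plane) :
    ‖Complex.exp (-(Real.pi * Complex.I * ((ω 0 * x 0 + ω 1 * x 1 : ℝ) : ℂ)))‖ = 1 := by
  rw [show -(Real.pi * Complex.I * ((ω 0 * x 0 + ω 1 * x 1 : ℝ) : ℂ)) =
    ((-(Real.pi * (ω 0 * x 0 + ω 1 * x 1)) : ℝ) : ℂ) * Complex.I by push_cast; ring,
    Complex.norm_exp_ofReal_mul_I]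

lemma integrable_mul_planeWave {h : Plane → ℂ} (hi : Integrable h) (ω : Plane) :
    Integrable fun x => h x *
      Complex.exp (-(Real.pi * Complex.I * ((ω 0 * x 0 + ω 1 * x 1 : ℝ) : ℂ))) :=
  hi.mul_bdd (c := 1) (continuous_planeWave ω).aestronglyMeasurable
    (Filter.Eventually.of_forall fun x => (norm_planeWave ω x).le)

lemma planeFourier_convolution {g h : Plane → ℂ} (hg : Integrable g) (hh : Integrable h)
    (ω : Plane) :
    planeFourier (convolution g h (ContinuousLinearMap.mul ℝ ℂ) volume) ω =
      planeFourier g ω * planeFourier h ω := by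
  have key := integral_convolution (ContinuousLinearMap.mul ℝ ℂ)
    (integrable_mul_planeWave hg ω) (integrable_mul_planeWave hh ω)
  rw [ContinuousLinearMap.mul_apply'] at key
  rw [planeFourier, planeFourier, planeFourier, ← key]
  congr 1
  funext x
  simp only [convolution, ContinuousLinearMap.mul_apply']
  rw [← integral_mul_const]
  congr 1
  funext t
  -- The plane wave is a character of the plane.
  rw [mul_mul_mul_comm, ← Complex.exp_add]
  congr 2
  simp only [PiLp.sub_apply]
  push_cast
  ring

/-- The convolution of two square-integrable functions is bounded. -/
lemma norm_convolution_le {g h : Plane → ℂ} (hg : MemLp g 2) (hh : MemLp h 2) (x : Plane) :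
    ‖convolution g h (ContinuousLinearMap.mul ℝ ℂ) volume x‖ ≤
      (∫ t, ‖g t‖ ^ 2) + ∫ t, ‖h t‖ ^ 2 := by
  have ig := (memLp_two_iff_integrable_sq_norm hg.1).1 hg
  have ih := (memLp_two_iff_integrable_sq_norm hh.1).1 hh
  have ih' : Integrable fun t => ‖h (x - t)‖ ^ 2 := ih.comp_sub_left x
  rw [← integral_sub_left_eq_self (fun t => ‖h t‖ ^ 2) volume x, ← integral_add ig ih']
  refine norm_integral_le_of_norm_le (ig.add ih') (Filter.Eventually.of_forall fun t => ?_)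
  simp only [ContinuousLinearMap.mul_apply', norm_mul]
  nlinarith [sq_nonneg (‖g t‖ - ‖h (x - t)‖), sq_nonneg ‖g t‖, sq_nonneg ‖h (x - t)‖]

lemma integrable_convolution_mul {g h : Plane → ℂ} (hg : Integrable g) (hh : Integrable h) :
    Integrable (convolution g h (ContinuousLinearMap.mul ℝ ℂ) volume) :=
  hg.integrable_convolution (ContinuousLinearMap.mul ℝ ℂ) hh

lemma memLp_convolution {g h : Plane → ℂ} (hg1 : Integrable g) (hh1 : Integrable h)
    (hg : MemLp g 2) (hh : MemLp h 2) :
    MemLp (convolution g h (ContinuousLinearMap.mul ℝ ℂ) volume) 2 := by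
  have hi := integrable_convolution_mul hg1 hh1
  rw [memLp_two_iff_integrable_sq_norm hi.1]
  refine (hi.norm.const_mul ((∫ t, ‖g t‖ ^ 2) + ∫ t, ‖h t‖ ^ 2)).mono' (hi.1.norm.pow 2)
    (Filter.Eventually.of_forall fun x => ?_)
  rw [Real.norm_of_nonneg (sq_nonneg _), sq]
  exact mul_le_mul_of_nonneg_right (norm_convolution_le hg hh x) (norm_nonneg _)

lemma zeroPaddedConv_of_lt {b : ℝ} (f₁ f₂ : Plane → ℂ) {x : Plane} (hx : b + b < ‖x‖) :
    zeroPaddedConv b f₁ f₂ x = 0 := by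
  unfold zeroPaddedConv convolution
  refine integral_eq_zero_of_ae (Filter.Eventually.of_forall fun t => ?_)
  simp only [ContinuousLinearMap.mul_apply', Pi.zero_apply]
  by_cases ht : b < ‖t‖
  · rw [zeroPad_of_lt f₁ ht, zero_mul]
  · have h1 : ‖x‖ ≤ ‖t‖ + ‖x - t‖ := by
      simpa using norm_add_le t (x - t)
    rw [zeroPad_of_lt f₂ (x := x - t) (by linarith), mul_zero]

/-- The Fourier integral of an integrable function supported in a disk, in polar coordinates. -/
lemma diskFourier_eq_planeFourier {b : ℝ} (hb : 0 ≤ b) {f : Plane → ℂ}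
    (hf : Integrable (zeroPad b f)) (ω : Plane) :
    diskFourier b f ω = planeFourier (zeroPad b f) ω := by
  rw [planeFourier, integral_eq_integral_polarPoint hb (integrable_mul_planeWave hf ω)
    fun x hx => by rw [zeroPad_of_lt f hx, zero_mul]]
  refine intervalIntegral.integral_congr fun r hr => ?_
  rw [Set.uIcc_of_le hb] at hr
  refine intervalIntegral.integral_congr fun θ _ => ?_
  simp only
  rw [zeroPad_of_le f (by rw [norm_polarPoint hr.1]; exact hr.2)]
  congr 3
  simp only [polarPoint_zero, polarPoint_one]
  push_cast
  ring

/-! ### The Fourier–Bessel functions as functions on the plane -/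

/-- The Fourier–Bessel function `Ψ_{nm}^a`, restricted to the disk of radius `a` and extended by
zero, in Cartesian coordinates. -/
noncomputable def planeFourierBessel (a : ℝ) (n : ℕ) (m : ℤ) : Plane → ℂ :=
  zeroPad a fun x => fourierBesselBasis a n m ‖x‖ (Complex.arg (Complex.mk (x 0) (x 1)))

lemma continuous_radialBessel (a : ℝ) (n : ℕ) (m : ℤ) : Continuous (radialBessel a n m) := by
  unfold radialBessel
  fun_prop

lemma norm_angularHarmonic_le (m : ℤ) (θ : ℝ) :
    ‖angularHarmonic m θ‖ ≤ 1 / Real.sqrt (2 * Real.pi) := by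
  unfold angularHarmonic
  rw [norm_mul, show Complex.I * m * θ = ((m * θ : ℝ) : ℂ) * Complex.I by push_cast; ring,
    Complex.norm_exp_ofReal_mul_I, mul_one, Complex.norm_real, Real.norm_of_nonneg (by positivity)]

lemma angularHarmonic_sub_int_mul (m j : ℤ) (θ : ℝ) :
    angularHarmonic m (θ - j * (2 * Real.pi)) = angularHarmonic m θ := by
  unfold angularHarmonic
  rw [show Complex.I * m * ((θ - j * (2 * Real.pi) : ℝ) : ℂ) =
    Complex.I * m * θ - ((m * j : ℤ) : ℂ) * (2 * Real.pi * Complex.I) by push_cast; ring,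
    Complex.exp_periodic.sub_int_mul_eq]

/-- In polar coordinates the choice of the angle does not matter, as `m` is an integer. -/
lemma planeFourierBessel_polarPoint {a : ℝ} (n : ℕ) (m : ℤ) {r : ℝ} (hr : 0 < r) (hra : r ≤ a)
    (θ : ℝ) : planeFourierBessel a n m (polarPoint r θ) = fourierBesselBasis a n m r θ := by
  rw [planeFourierBessel, zeroPad_of_le _ (by rwa [norm_polarPoint hr.le]), norm_polarPoint hr.le]
  unfold fourierBesselBasis
  congr 1
  have e : Complex.mk (polarPoint r θ 0) (polarPoint r θ 1) =
      r * (Complex.cos θ + Complex.sin θ * Complex.I) := by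
    apply Complex.ext <;> simp [← Complex.ofReal_cos, ← Complex.ofReal_sin]
  rw [e, Complex.arg_mul_cos_add_sin_mul_I_eq_toIocMod hr, toIocMod, zsmul_eq_mul,
    angularHarmonic_sub_int_mul]

lemma measurable_fourierBesselBasis_comp (a : ℝ) (n : ℕ) (m : ℤ) : Measurable fun x : Plane =>
    fourierBesselBasis a n m ‖x‖ (Complex.arg (Complex.mk (x 0) (x 1))) := by
  have h1 : Measurable fun x : Plane => Complex.arg (Complex.mk (x 0) (x 1)) := by
    have h0 : Measurable fun x : Plane => (x 0, x 1) := by fun_prop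
    exact Complex.measurable_arg.comp (Complex.measurableEquivRealProd.symm.measurable.comp h0)
  unfold fourierBesselBasis angularHarmonic
  have h2 := (continuous_radialBessel a n m).measurable
  fun_prop

lemma exists_norm_planeFourierBessel_le (a : ℝ) (n : ℕ) (m : ℤ) :
    ∃ C, ∀ x, ‖planeFourierBessel a n m x‖ ≤ C := by
  obtain ⟨C, hC⟩ := (isCompact_Icc (a := 0) (b := a)).exists_bound_of_continuousOn
    (continuous_radialBessel a n m).continuousOn
  refine ⟨max (C * (1 / Real.sqrt (2 * Real.pi))) 0, fun x => ?_⟩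
  rcases lt_or_ge a ‖x‖ with hx | hx
  · rw [planeFourierBessel, zeroPad_of_lt _ hx, norm_zero]
    exact le_max_right _ _
  · rw [planeFourierBessel, zeroPad_of_le _ hx, fourierBesselBasis, norm_mul, Complex.norm_real]
    refine le_max_of_le_left ?_
    have := hC ‖x‖ ⟨norm_nonneg _, hx⟩
    exact mul_le_mul this (norm_angularHarmonic_le _ _) (norm_nonneg _)
      ((norm_nonneg _).trans this)

lemma aestronglyMeasurable_planeFourierBessel (a : ℝ) (n : ℕ) (m : ℤ) :
    AEStronglyMeasurable (planeFourierBessel a n m) :=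
  ((measurable_fourierBesselBasis_comp a n m).indicator
    measurableSet_closedBall).aestronglyMeasurable

lemma memLp_planeFourierBessel_restrict (a : ℝ) (n : ℕ) (m : ℤ) :
    MemLp (planeFourierBessel a n m) 2 (volume.restrict (Metric.closedBall (0 : Plane) a)) := by
  have : IsFiniteMeasure (volume.restrict (Metric.closedBall (0 : Plane) a)) :=
    ⟨by rw [Measure.restrict_apply_univ]; exact measure_closedBall_lt_top⟩
  obtain ⟨C, hC⟩ := exists_norm_planeFourierBessel_le a n m
  exact MemLp.of_bound (aestronglyMeasurable_planeFourierBessel a n m).restrict C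
    (Filter.Eventually.of_forall hC)

lemma zeroPad_planeFourierBessel (a : ℝ) (n : ℕ) (m : ℤ) :
    zeroPad a (planeFourierBessel a n m) = planeFourierBessel a n m := by
  unfold planeFourierBessel zeroPad
  rw [Set.indicator_indicator, Set.inter_self]

lemma memLp_planeFourierBessel (a : ℝ) (n : ℕ) (m : ℤ) : MemLp (planeFourierBessel a n m) 2 := by
  have := memLp_zeroPad (memLp_planeFourierBessel_restrict a n m)
  rwa [zeroPad_planeFourierBessel] at this

lemma integrable_planeFourierBessel (a : ℝ) (n : ℕ) (m : ℤ) :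
    Integrable (planeFourierBessel a n m) := by
  have := integrable_zeroPad (memLp_planeFourierBessel_restrict a n m)
  rwa [zeroPad_planeFourierBessel] at this

lemma planeFourierBessel_of_lt {a : ℝ} (n : ℕ) (m : ℤ) {x : Plane} (hx : a < ‖x‖) :
    planeFourierBessel a n m x = 0 :=
  zeroPad_of_lt _ hx

lemma fourierBesselCoeff_eq_integral {a : ℝ} (ha : 0 < a) (n : ℕ) (m : ℤ) {h : Plane → ℂ}
    (hh : Integrable h) :
    fourierBesselCoeff a n m h = ∫ x, (starRingEnd ℂ) (planeFourierBessel a n m x) * h x := by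
  obtain ⟨C, hC⟩ := exists_norm_planeFourierBessel_le a n m
  have hi : Integrable fun x => (starRingEnd ℂ) (planeFourierBessel a n m x) * h x :=
    hh.bdd_mul (c := C)
      (Complex.continuous_conj.comp_aestronglyMeasurable
        (aestronglyMeasurable_planeFourierBessel a n m))
      (Filter.Eventually.of_forall fun x => by rw [RCLike.norm_conj]; exact hC x)
  rw [integral_eq_integral_polarPoint ha.le hi
    fun x hx => by rw [planeFourierBessel_of_lt n m hx, map_zero, zero_mul]]
  unfold fourierBesselCoeff
  rw [intervalIntegral.integral_of_le ha.le, intervalIntegral.integral_of_le ha.le]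
  refine setIntegral_congr_fun measurableSet_Ioc fun r hr => ?_
  refine intervalIntegral.integral_congr fun θ _ => ?_
  rw [planeFourierBessel_polarPoint n m hr.1 hr.2, mul_comm (h _)]

/-- The Fourier integral of a Fourier–Bessel function: the angular integration is Jacobi–Anger,
the radial one is a Lommel integral. -/
lemma planeFourier_planeFourierBessel {a : ℝ} (ha : 0 < a) {n : ℕ} (hn : 1 ≤ n) (m : ℤ)
    (x : Plane) :
    planeFourier (planeFourierBessel a n m) (a⁻¹ • x) =
      2 * Real.pi * (1 / Real.sqrt (2 * Real.pi) : ℝ) * (1 / Real.sqrt (besselNorm a n m) : ℝ) *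
      (-Complex.I) ^ m * Complex.exp (Complex.I * m * polarAngle x) *
      (a ^ 2 * (besselZero m n * deriv (besselJ m) (besselZero m n) *
        besselQuotient m (besselZero m n) (Real.pi * ‖x‖)) : ℝ) := by
  obtain ⟨hz, hJ, -⟩ := exists_sign_deriv_besselJ m hn
  set z := besselZero m n with hzdef
  set φ := polarAngle x
  rw [planeFourier, integral_eq_integral_polarPoint ha.le
    (integrable_mul_planeWave (integrable_planeFourierBessel a n m) _)
    fun x hx => by rw [planeFourierBessel_of_lt n m hx, zero_mul]]
  set K : ℂ := 2 * Real.pi * (1 / Real.sqrt (2 * Real.pi) : ℝ) *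
    (1 / Real.sqrt (besselNorm a n m) : ℝ) *
      (-Complex.I) ^ m * Complex.exp (Complex.I * m * φ) with hK
  set L : ℝ → ℝ := fun s => s * (besselJ m (z * s) * besselJ m (Real.pi * ‖x‖ * s)) with hL
  have hinner : ∀ r ∈ Set.Ioc 0 a, ∫ θ in (0 : ℝ)..(2 * Real.pi),
      planeFourierBessel a n m (polarPoint r θ) *
        Complex.exp (-(Real.pi * Complex.I * (((a⁻¹ • x) 0 * polarPoint r θ 0 +
          (a⁻¹ • x) 1 * polarPoint r θ 1 : ℝ) : ℂ))) * (r : ℂ) =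
      K * ((a * L (a⁻¹ * r) : ℝ) : ℂ) := by
    intro r hr
    have h1 : ∀ θ : ℝ, planeFourierBessel a n m (polarPoint r θ) *
        Complex.exp (-(Real.pi * Complex.I * (((a⁻¹ • x) 0 * polarPoint r θ 0 +
          (a⁻¹ • x) 1 * polarPoint r θ 1 : ℝ) : ℂ))) * (r : ℂ) =
        (radialBessel a n m r : ℂ) * ((1 / Real.sqrt (2 * Real.pi) : ℝ) : ℂ) * r *
        (Complex.exp (Complex.I * m * θ) * Complex.exp (-(Complex.I *
          (Real.pi * ‖x‖ * (a⁻¹ * r) * Real.cos (θ - φ) : ℝ)))) := by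
      intro θ
      have e : Real.pi * ((a⁻¹ • x) 0 * polarPoint r θ 0 + (a⁻¹ • x) 1 * polarPoint r θ 1) =
          Real.pi * ‖x‖ * (a⁻¹ * r) * Real.cos (θ - φ) := by
        simp only [PiLp.smul_apply, smul_eq_mul, polarPoint_zero, polarPoint_one]
        rw [← norm_mul_cos_polarAngle x, ← norm_mul_sin_polarAngle x, Real.cos_sub]
        ring
      rw [planeFourierBessel_polarPoint n m hr.1 hr.2, fourierBesselBasis, angularHarmonic, ← e]
      push_cast
      ring_nf
    simp only [h1]
    rw [intervalIntegral.integral_const_mul, integral_exp_mul_planeWave, radialBessel, besselRho,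
      ← hzdef, hK]
    simp only [hL]
    rw [show z * (a⁻¹ * r) = a⁻¹ * z * r by ring]
    have ha' : (a : ℂ) ≠ 0 := by exact_mod_cast ha.ne'
    push_cast
    field_simp
  rw [intervalIntegral.integral_of_le ha.le, setIntegral_congr_fun measurableSet_Ioc hinner,
    ← intervalIntegral.integral_of_le ha.le, intervalIntegral.integral_const_mul,
    intervalIntegral.integral_ofReal, intervalIntegral.integral_const_mul,
    intervalIntegral.integral_comp_mul_left L (inv_ne_zero ha.ne'), mul_zero,
    inv_mul_cancel₀ ha.ne', inv_inv, hL, integral_besselJ_mul_besselJ_of_zero m hz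
      (by positivity) hJ, smul_eq_mul]
  congr 2
  ring

/-- The conjugate Fourier coefficients of `Ψ_{nm}^a` on the square of side `2 a` are the coefficients
of the theorem. -/
lemma latticeCoeff_eq {a : ℝ} (ha : 0 < a) {n : ℕ} (hn : 1 ≤ n) (m : ℤ) (k : ℤ × ℤ) :
    ((4 * a ^ 2 : ℝ) : ℂ)⁻¹ * (starRingEnd ℂ)
      (planeFourier (planeFourierBessel a n m) (a⁻¹ • latticePoint k)) =
      latticeCoeff a k n m := by
  rw [planeFourier_planeFourierBessel ha hn]
  obtain ⟨hz, -, ε, hε, hI, hsign⟩ := exists_sign_deriv_besselJ m hn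
  unfold latticeCoeff besselNorm besselRho
  set z := besselZero m n
  set D := deriv (besselJ m) z
  set Q := besselQuotient m z (Real.pi * ‖latticePoint k‖)
  -- The sign of `J_m'(z)` turns `i ^ m` into `(-1) ^ n i ^ |m|`.
  have hn1 : ((-1 : ℝ) ^ n) * (-1) ^ n = 1 := by rw [← mul_pow]; simp
  obtain ⟨E, hE, hDE⟩ : ∃ E : ℝ, 0 < E ∧ D = (-1) ^ n * ε * E :=
    ⟨(-1) ^ n * ε * D, hsign, by linear_combination (-D) * hε - D * ε * ε * hn1⟩
  have hsq : D ^ 2 = E ^ 2 := by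
    rw [hDE]
    linear_combination E ^ 2 * ε ^ 2 * hn1 + E ^ 2 * hε
  have hN : √(a ^ 2 / 2 * D ^ 2) = a * E / √2 := by
    rw [hsq, show a ^ 2 / 2 * E ^ 2 = (a * E) ^ 2 / 2 by ring, Real.sqrt_div' _ (by norm_num),
      Real.sqrt_sq (by positivity)]
  have hpi : √(2 * Real.pi) = √2 * √Real.pi := Real.sqrt_mul (by norm_num) _
  have hreal : (4 * a ^ 2)⁻¹ * (2 * Real.pi * (1 / √(2 * Real.pi)) * (1 / √(a ^ 2 / 2 * D ^ 2)) *
      (a ^ 2 * (z * D * Q))) = √Real.pi * ((-1) ^ n * ε) * (a⁻¹ * z) * Q / 2 := by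
    have h2 : √2 ^ 2 = 2 := Real.sq_sqrt (by norm_num)
    have hp : √Real.pi ^ 2 = Real.pi := Real.sq_sqrt Real.pi_pos.le
    have hp0 : √Real.pi ≠ 0 := (Real.sqrt_pos.2 Real.pi_pos).ne'
    rw [hN, hpi, hDE]
    nth_rewrite 1 [← hp]
    field_simp
    norm_num
  have hconj : (starRingEnd ℂ) ((-Complex.I) ^ m) = ε * Complex.I ^ m.natAbs := by
    rw [map_zpow₀, map_neg, Complex.conj_I, neg_neg, hI]
  have hexp : (starRingEnd ℂ) (Complex.exp (Complex.I * m * polarAngle (latticePoint k))) =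
      Complex.exp (-(Complex.I * m * polarAngle (latticePoint k))) := by
    rw [← Complex.exp_conj]
    simp
  simp only [map_mul, Complex.conj_ofReal, hconj, hexp, map_ofNat]
  have hrealC := congrArg (fun t : ℝ => (t : ℂ)) hreal
  have hεC : (ε : ℂ) * ε = 1 := by exact_mod_cast hε
  push_cast at hrealC ⊢
  linear_combination (ε * Complex.I ^ m.natAbs *
    Complex.exp (-(Complex.I * m * polarAngle (latticePoint k)))) * hrealC +
    (√Real.pi * (-1) ^ n * (a⁻¹ * z) * Q / 2 * Complex.I ^ m.natAbs *
    Complex.exp (-(Complex.I * m * polarAngle (latticePoint k)))) * hεC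

theorem mainTheorem1 (a b : ℝ) (ha : 0 < a) (hb : b = a / 2)
    (f₁ f₂ : Plane → ℂ)
    (hf₁ : MemLp f₁ 2 (volume.restrict (Metric.closedBall (0 : Plane) b)))
    (hf₂ : MemLp f₂ 2 (volume.restrict (Metric.closedBall (0 : Plane) b)))
    (m : ℤ) (n : ℕ) (hn : 1 ≤ n) :
    HasSum
      (fun k : ℤ × ℤ =>
        latticeCoeff a k n m * diskFourier b f₁ (a⁻¹ • latticePoint k) *
          diskFourier b f₂ (a⁻¹ • latticePoint k))
      (fourierBesselCoeff a n m (zeroPaddedConv b f₁ f₂)) := by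
  have hb0 : 0 ≤ b := by linarith
  have hi₁ := integrable_zeroPad hf₁
  have hi₂ := integrable_zeroPad hf₂
  have key := hasSum_planeFourier ha (memLp_planeFourierBessel a n m)
    (memLp_convolution hi₁ hi₂ (memLp_zeroPad hf₁) (memLp_zeroPad hf₂))
    (fun x hx => planeFourierBessel_of_lt n m hx)
    (fun x hx => zeroPaddedConv_of_lt f₁ f₂ (by linarith))
  rw [← fourierBesselCoeff_eq_integral ha n m (integrable_convolution_mul hi₁ hi₂)] at key
  refine key.congr_fun fun k => ?_
  rw [latticeCoeff_eq ha hn, planeFourier_convolution hi₁ hi₂,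
    diskFourier_eq_planeFourier hb0 hi₁, diskFourier_eq_planeFourier hb0 hi₂, mul_assoc]
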